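/- Let $H_n=\mathbb C^n\times\mathbb R$ be the Heisenberg group with coordinates $(z,t)$, $z=x+iy$, and multiplication $(x,y,t)\circ(x',y',t')=(x+x',\,y+y',\,t+t'+y\cdot x'-x\cdot y')$. It carries the contact form $\Theta=dt+\sum_\beta (x_\beta\,dy_\beta-y_\beta\,dx_\beta)$, the contact bundle $\xi=\ker\Theta$ framed by the left-invariant fields $\mathring e_\beta=\partial_{x_\beta}+y_\beta\partial_t$ and $\mathring e_{n+\beta}=\partial_{y_\beta}-x_\beta\partial_t$, the CR structure $J\mathring e_\beta=\mathring e_{n+\beta}$, $J\mathring e_{n+\beta}=-\mathring e_\beta$, and the Reeb field $T=\partial_t$. Put $\mathring Z_\beta=\frac12(\mathring e_\beta-i\mathring e_{n+\beta})$; let $\langle\ ,\ \rangle$ be the Levi metric, the Hermitian metric on $\xi_{1,0}$ for which the $\mathring Z_\beta$ are orthonormal, and $\nabla$ the pseudohermitian connection of $H_n$, for which the $\mathring Z_\beta$ are parallel. A pseudohermitian transformation of $H_n$ is a diffeomorphism preserving $\Theta$ and $J$; a Heisenberg rigid motion is such a transformation, and it has the form $L_p\circ\Phi_U$ with $L_p$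 a left translation and $\Phi_U(z,t)=(Uz,t)$, $U\in U(n)$. A pseudohermitian submanifold of $H_n$ of CR dimension $m\ge 1$ is an injectively immersed smooth manifold $M\subset H_n$ of dimension $2m+1$ such that $\hat\theta=\Theta|_M$ vanishes at no point and $\hat\xi=TM\cap\xi=\ker\hat\theta$ is $J$-invariant; it is equipped with $\hat\theta$ and $\hat J=J|_{\hat\xi}$. Let $\hat\xi^\perp$ be the orthogonal complement of $\hat\xi$ in $\xi|_M$. The fundamental vector field $\nu$ is the section of $\hat\xi^\perp$ such that $T+\nu$ is tangent to $M$, and $M$ is called vertical if $\nu\equiv 0$. The second fundamental form $II$ is given, for $X,Y\in\hat\xi_{1,0}$ and local sections $N$ of $\hat\xi^\perp_{1,0}$, by $II^N(X,Y)=-\langle X,\nabla_{\overline Y}N\rangle$, and $II=0$ means that all these components vanish. **Theorem.** Let $n\ge 2$ and let $M$ be a vertical, simply connected pseudohermitian submanifold of $H_n$ of CR dimension $m=n-1$ with $II=0$. Then, after a Heisenberg rigid motion, $M$ is an open subset of the Heisenberg subgroup $H_{n-1}=\{z_n=0\}$: the inclusion of $M$ in $H_n$ is a topological embedding, and there is a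 Heisenberg rigid motion $\Phi$ of $H_n$ such that $\Phi(M)$ is an open subset of $\{z_n=0\}$. -/

import Mathlib

open scoped Manifold ContDiff Topology

/-- The Heisenberg group `H_n = ℂⁿ × ℝ` with coordinates `(z, t)`, `z = x + i y`, and its usual
smooth structure. All tangent spaces are identified with `ℂⁿ × ℝ`: the pair `(w, s)` stands for
`∑ (Re w_β ∂/∂x_β + Im w_β ∂/∂y_β) + s ∂/∂t`. -/
abbrev Heisenberg (n : ℕ) : Type := (Fin n → ℂ) × ℝ

namespace Heisenberg

variable {n : ℕ}

/-- The group law `(x,y,t) ∘ (x',y',t') = (x + x', y + y', t + t' + y x' - x y')`, which is the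
left translation `L_p` applied to `q`. -/
noncomputable def leftTranslation (p q : Heisenberg n) : Heisenberg n :=
  (p.1 + q.1,
    p.2 + q.2 + ∑ β, ((p.1 β).im * (q.1 β).re - (p.1 β).re * (q.1 β).im))

/-- The rotation `(z, t) ↦ (U z, t)` about the `t`-axis. For `U = A + i B` unitary this is the
real matrix `[[A, -B], [B, A]]` in `SO(2n)` acting on `(x, y)`. -/
noncomputable def rotation (U : Matrix.unitaryGroup (Fin n) ℂ) (q : Heisenberg n) :
    Heisenberg n :=
  ((U : Matrix (Fin n) (Fin n) ℂ).mulVec q.1, q.2)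

/-- The contact form `Θ = dt + ∑ (x_β dy_β - y_β dx_β)` at `q`, evaluated on the vector `v`. -/
noncomputable def contactForm (q v : Heisenberg n) : ℝ :=
  v.2 + ∑ β, ((q.1 β).re * (v.1 β).im - (q.1 β).im * (v.1 β).re)

/-- The horizontal vector at `q` (an element of `ξ = ker Θ`) whose coefficients in the
left-invariant frame `e_β = ∂/∂x_β + y_β ∂/∂t`, `e_{n+β} = ∂/∂y_β - x_β ∂/∂t` are the real and
imaginary parts of `w`, that is `∑ (Re w_β e_β + Im w_β e_{n+β})`. -/
noncomputable def horizontalLift (q : Heisenberg n) (w : Fin n → ℂ) : Heisenberg n :=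
  (w, ∑ β, ((q.1 β).im * (w β).re - (q.1 β).re * (w β).im))

/-- The CR structure `J e_β = e_{n+β}`, `J e_{n+β} = -e_β`, on horizontal vectors at `q`. -/
noncomputable def complexStructure (q v : Heisenberg n) : Heisenberg n :=
  horizontalLift q (Complex.I • v.1)

/-- The Reeb field `T = ∂/∂t`. -/
def reeb : Heisenberg n := (0, 1)

/-- The Levi (Hermitian) metric on horizontal vectors of type `(1,0)`. The vector
`∑ c_β Z_β`, `Z_β = (e_β - i e_{n+β}) / 2`, is represented by its coefficients `c`,
and the `Z_β` are orthonormal. -/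
noncomputable def levi (c d : Fin n → ℂ) : ℂ := ∑ β, c β * (starRingEnd ℂ) (d β)

/-- Pseudohermitian transformations of `H_n` (the elements of `PSH(n)`): the diffeomorphisms that
preserve `Θ` and `J`. -/
structure IsPseudohermitianTransformation (Φ : Heisenberg n ≃ Heisenberg n) : Prop where
  smooth : ContDiff ℝ ∞ Φ
  smooth_symm : ContDiff ℝ ∞ Φ.symm
  contactForm_eq : ∀ q v : Heisenberg n, contactForm (Φ q) (fderiv ℝ Φ q v) = contactForm q v
  complexStructure_eq : ∀ q v : Heisenberg n, contactForm q v = 0 →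
    fderiv ℝ Φ q (complexStructure q v) = complexStructure (Φ q) (fderiv ℝ Φ q v)

/-- Heisenberg rigid motions: pseudohermitian transformations of `H_n`, written as a rotation about
the `t`-axis followed by a left translation. -/
def IsRigidMotion (Φ : Heisenberg n ≃ Heisenberg n) : Prop :=
  IsPseudohermitianTransformation Φ ∧
    ∃ (p : Heisenberg n) (U : Matrix.unitaryGroup (Fin n) ℂ),
      ∀ q, Φ q = leftTranslation p (rotation U q)

/-- The Heisenberg subgroup `H_m = {z_{m+1} = 0}` of `H_{m+1}`. -/
def subgroup (m : ℕ) : Set (Heisenberg (m + 1)) := {q | q.1 (Fin.last m) = 0}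

end Heisenberg

section Submanifold

open Heisenberg

variable (m : ℕ) {n : ℕ} {M : Type*} [TopologicalSpace M]
  [ChartedSpace (EuclideanSpace ℝ (Fin (2 * m + 1))) M]

/-- The differential of `f : M → H_n` at `p`, for `M` of dimension `2m + 1`. -/
noncomputable def tangentMapAt (f : M → Heisenberg n) (p : M) :
    TangentSpace (𝓡 (2 * m + 1)) p →L[ℝ] Heisenberg n :=
  mfderiv (𝓡 (2 * m + 1)) 𝓘(ℝ, Heisenberg n) f p

/-- The induced form `θ̂ = f^* Θ` at `p`. -/
noncomputable def inducedForm (f : M → Heisenberg n) (p : M)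
    (v : TangentSpace (𝓡 (2 * m + 1)) p) : ℝ :=
  contactForm (f p) (tangentMapAt m f p v)

/-- `ξ̂ = TM ∩ ξ` at `p`, as a subspace of `T_p M`. -/
noncomputable def contactPlane (f : M → Heisenberg n) (p : M) :
    Submodule ℝ (TangentSpace (𝓡 (2 * m + 1)) p) where
  carrier := {v | inducedForm m f p v = 0}
  zero_mem' := by simp [inducedForm, contactForm]
  add_mem' := by
    intro a b ha hb
    simp only [Set.mem_ofPred_eq, inducedForm, contactForm] at ha hb ⊢
    rw [map_add]
    have : ∀ u v : Heisenberg n, (u + v).2 + ∑ β, (((f p).1 β).re * ((u + v).1 β).im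
        - ((f p).1 β).im * ((u + v).1 β).re)
        = (u.2 + ∑ β, (((f p).1 β).re * (u.1 β).im - ((f p).1 β).im * (u.1 β).re))
        + (v.2 + ∑ β, (((f p).1 β).re * (v.1 β).im - ((f p).1 β).im * (v.1 β).re)) := by
      intro u v
      have h : ∑ β, (((f p).1 β).re * ((u + v).1 β).im - ((f p).1 β).im * ((u + v).1 β).re)
          = ∑ β, (((f p).1 β).re * (u.1 β).im - ((f p).1 β).im * (u.1 β).re)
          + ∑ β, (((f p).1 β).re * (v.1 β).im - ((f p).1 β).im * (v.1 β).re) := by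
        rw [← Finset.sum_add_distrib]
        refine Finset.sum_congr rfl fun β _ => ?_
        simp only [Prod.fst_add, Pi.add_apply, Complex.add_re, Complex.add_im]
        ring
      rw [h, Prod.snd_add]
      ring
    rw [this, ha, hb, add_zero]
  smul_mem' := by
    intro c a ha
    simp only [Set.mem_ofPred_eq, inducedForm, contactForm] at ha ⊢
    rw [map_smul]
    have : ∀ u : Heisenberg n, (c • u).2 + ∑ β, (((f p).1 β).re * ((c • u).1 β).im
        - ((f p).1 β).im * ((c • u).1 β).re)
        = c * (u.2 + ∑ β, (((f p).1 β).re * (u.1 β).im - ((f p).1 β).im * (u.1 β).re)) := by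
      intro u
      rw [mul_add, Finset.mul_sum]
      congr 1
      refine Finset.sum_congr rfl fun β _ => ?_
      simp only [Prod.smul_fst, Pi.smul_apply, Complex.real_smul, Complex.mul_re, Complex.mul_im,
        Complex.ofReal_re, Complex.ofReal_im]
      ring
    rw [this, ha, mul_zero]

variable (n M) in
/-- A `(2m+1)`-dimensional pseudohermitian submanifold `(M, Ĵ, θ̂)` of `H_n` of CR dimension `m`:
an injectively immersed smooth submanifold such that `θ̂ = Θ|_M` vanishes at no point (so that
`ξ̂ = ker θ̂ = TM ∩ ξ` is a hyperplane field) with `Ĵ = J|_ξ̂` mapping `ξ̂` to itself. As `dΘ` is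
positive on complex lines in `ξ` and `ξ_{1,0}` is involutive, the contact condition and the CR
integrability of the induced structure hold automatically. -/
structure PseudohermitianSubmanifold where
  /-- the inclusion of `M` in `H_n` -/
  toFun : M → Heisenberg n
  smooth : ContMDiff (𝓡 (2 * m + 1)) 𝓘(ℝ, Heisenberg n) ∞ toFun
  injective : Function.Injective toFun
  immersion : ∀ p, Function.Injective (tangentMapAt m toFun p)
  /-- `θ̂` is nowhere zero -/
  inducedForm_ne : ∀ p, ∃ v, inducedForm m toFun p v ≠ 0
  /-- the complex structure `Ĵ` on `ξ̂` -/
  J : ∀ p, contactPlane m toFun p →ₗ[ℝ] contactPlane m toFun p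
  /-- `Ĵ` is the restriction of the complex structure `J` of `H_n` -/
  J_eq : ∀ (p : M) (v : contactPlane m toFun p),
    tangentMapAt m toFun p (J p v) = complexStructure (toFun p) (tangentMapAt m toFun p v)

namespace PseudohermitianSubmanifold

variable {m} (S : PseudohermitianSubmanifold m n M)

/-- For `v ∈ ξ̂_p`, the coefficients of the `(1,0)`-vector `V = (v - i Ĵ v) / 2` in the frame
`Z_β`. If `v = ∑ (a_β e_β + b_β e_{n+β})`, they are `a_β + i b_β`. Every element of `ξ̂_{1,0}` at
`p` is `V` for exactly one `v`. -/
noncomputable def holPart (p : M) (v : contactPlane m S.toFun p) : Fin n → ℂ :=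
  (tangentMapAt m S.toFun p v).1

/-- The vector `∑ c_β Z_β` belongs to the orthogonal complement `ξ̂^⊥_{1,0}` of `ξ̂_{1,0}` at `p`;
equivalently its (doubled) real part `horizontalLift (S.toFun p) c` belongs to `ξ̂^⊥`. -/
def IsNormalAt (p : M) (c : Fin n → ℂ) : Prop :=
  ∀ v : contactPlane m S.toFun p, levi (S.holPart p v) c = 0

/-- `ν = horizontalLift (S.toFun p) c` is the fundamental vector at `p`: `ν` is horizontal, it is
orthogonal to `ξ̂`, and `T + ν` is tangent to `M`. -/
def IsFundamentalVectorAt (p : M) (c : Fin n → ℂ) : Prop :=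
  S.IsNormalAt p c ∧ ∃ v, tangentMapAt m S.toFun p v = reeb + horizontalLift (S.toFun p) c

/-- `M` is vertical: its fundamental vector field `ν` vanishes identically. -/
def IsVertical : Prop := ∀ p, S.IsFundamentalVectorAt p 0

/-- `N = ∑ N_β Z_β`, with coefficients `N_β : M → ℂ`, is a smooth section of the normal bundle
`ξ̂^⊥_{1,0}` over `U`. -/
def IsNormalFieldOn (U : Set M) (N : M → Fin n → ℂ) : Prop :=
  ContMDiffOn (𝓡 (2 * m + 1)) 𝓘(ℝ, Fin n → ℂ) ∞ N U ∧ ∀ q ∈ U, S.IsNormalAt q (N q)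

/-- `∇_v N` for `v ∈ T_p M` and a `(1,0)`-field `N = ∑ N_β Z_β` along `M`. Here `∇` is the
pseudohermitian (Tanaka--Webster) connection of `H_n`, the flat connection for which the
left-invariant fields `Z_β` are parallel, so that `∇_v N = ∑ (v N_β) Z_β`. -/
noncomputable def covDeriv (N : M → Fin n → ℂ) (p : M) (v : TangentSpace (𝓡 (2 * m + 1)) p) :
    Fin n → ℂ :=
  mfderiv (𝓡 (2 * m + 1)) 𝓘(ℝ, Fin n → ℂ) N p v

/-- `∇_{\bar Y} N` at `p` for `Y = (y - i Ĵ y) / 2 ∈ ξ̂_{1,0}`, where `y ∈ ξ̂_p`. -/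
noncomputable def covDerivBar (N : M → Fin n → ℂ) (p : M) (y : contactPlane m S.toFun p) :
    Fin n → ℂ :=
  (1 / 2 : ℂ) • (covDeriv (m := m) N p y.1 + Complex.I • covDeriv (m := m) N p (S.J p y).1)

/-- The component `II^N(X, Y) = - ⟨X, ∇_{\bar Y} N⟩` of the second fundamental form in the
direction of the normal field `N`, at `p`, for `X = (x - i Ĵ x) / 2` and `Y = (y - i Ĵ y) / 2` in
`ξ̂_{1,0}`. -/
noncomputable def secondFundamentalForm (N : M → Fin n → ℂ) (p : M)
    (x y : contactPlane m S.toFun p) : ℂ :=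
  - levi (S.holPart p x) (S.covDerivBar N p y)

/-- `II = 0`: all components of the second fundamental form vanish, with respect to all local
sections of the normal bundle. -/
def SecondFundamentalFormVanishes : Prop :=
  ∀ (U : Set M) (N : M → Fin n → ℂ), IsOpen U → S.IsNormalFieldOn U N →
    ∀ p ∈ U, ∀ x y : contactPlane m S.toFun p, S.secondFundamentalForm N p x y = 0

end PseudohermitianSubmanifold

end Submanifold

/-! Let `z : M → ℂⁿ` be the coordinate map. As `M` is vertical, the image `W` of `dz` at a point
is the image of `ξ̂`, a complex `m`-plane in `ℂⁿ`. For a normal field `N`, differentiating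
`⟨dz X, N⟩ = 0` and using the symmetry of the second derivative of `z` shows that `⟨dz X, ∇_Y N⟩` is
symmetric in the real vectors `X` and `Y`. It is therefore conjugate linear in `Y` as well as in
`X`, so it coincides up to sign with `II` and `II = 0` forces all derivatives of `N` to be normal.
For the orthogonal projection `P` onto `W` and the normal fields `c - P c` this says `P dP = 0`,
and then `dP = P dP + dP P = dP P = (P dP)ᴴ = 0`: the plane `W` is constant. A rotation brings it
to `ℂᵐ`, and a translation brings `M` into `H_m`. Forgetting the vanishing coordinates is then a
local diffeomorphism from `M` to `H_m`, so `M` is open in `H_m`.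
-/

section Charts

variable {𝕜 : Type*} [RCLike 𝕜] {E V : Type*} [NormedAddCommGroup E] [NormedSpace 𝕜 E]
  [NormedAddCommGroup V] [NormedSpace 𝕜 V] {M : Type*} [TopologicalSpace M] [ChartedSpace E M]
  {z : M → V} {p q : M}

variable (𝕜) in
/-- The differential of `z` at `q` read in the preferred chart at `p`. Unlike `mfderiv`, whose
source varies with `q`, it takes values in a fixed space, so that its smoothness in `q` makes
sense. It is meaningful only for `q` in the source of that chart. -/
noncomputable def mfderivInChart (z : M → V) (p q : M) : E →L[𝕜] V :=
  fderiv 𝕜 (z ∘ (chartAt E p).symm) (chartAt E p q)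

theorem contDiffAt_comp_chartAt_symm {k : ℕ∞ω} [IsManifold 𝓘(𝕜, E) k M]
    (hz : ContMDiffAt 𝓘(𝕜, E) 𝓘(𝕜, V) k z q) (hq : q ∈ (chartAt E p).source) :
    ContDiffAt 𝕜 k (z ∘ (chartAt E p).symm) (chartAt E p q) := by
  rw [← contMDiffAt_iff_contDiffAt]
  exact hz.comp_of_eq ((contMDiffOn_chart_symm (x := p)).contMDiffAt
    ((chartAt E p).open_target.mem_nhds ((chartAt E p).map_source hq)))
    ((chartAt E p).left_inv hq)

theorem contMDiffAt_mfderivInChart {k : ℕ∞ω} [IsManifold 𝓘(𝕜, E) (k + 1) M]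
    (hz : ContMDiffAt 𝓘(𝕜, E) 𝓘(𝕜, V) (k + 1) z q) (hq : q ∈ (chartAt E p).source) :
    ContMDiffAt 𝓘(𝕜, E) 𝓘(𝕜, E →L[𝕜] V) k
      (mfderivInChart 𝕜 z p : M → E →L[𝕜] V) q := by
  have : IsManifold 𝓘(𝕜, E) k M := .of_le (n := k + 1) le_self_add
  have hfderiv : ContDiffAt 𝕜 k (fderiv 𝕜 (z ∘ (chartAt E p).symm)) (chartAt E p q) :=
    (contDiffAt_comp_chartAt_symm hz hq).fderiv_right le_rfl
  exact hfderiv.comp_contMDiffAt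
    (contMDiffOn_chart.contMDiffAt ((chartAt E p).open_source.mem_nhds hq))

variable [IsManifold 𝓘(𝕜, E) 1 M]

theorem differentiableAt_comp_chartAt_symm (hz : MDifferentiableAt 𝓘(𝕜, E) 𝓘(𝕜, V) z q)
    (hq : q ∈ (chartAt E p).source) :
    DifferentiableAt 𝕜 (z ∘ (chartAt E p).symm) (chartAt E p q) := by
  rw [← mdifferentiableAt_iff_differentiableAt]
  refine MDifferentiableAt.comp (I' := 𝓘(𝕜, E)) _ ?_
    ((mdifferentiable_chart (I := 𝓘(𝕜, E)) p).mdifferentiableAt_symm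
      ((chartAt E p).map_source hq))
  rwa [(chartAt E p).left_inv hq]

theorem mfderiv_apply_eq_mfderivInChart (hz : MDifferentiableAt 𝓘(𝕜, E) 𝓘(𝕜, V) z q)
    (hq : q ∈ (chartAt E p).source) (v : TangentSpace 𝓘(𝕜, E) q) :
    mfderiv 𝓘(𝕜, E) 𝓘(𝕜, V) z q v =
      (mfderivInChart 𝕜 z p q : E →L[𝕜] V) (mfderiv 𝓘(𝕜, E) 𝓘(𝕜, E) (chartAt E p) q v) := by
  have hchart := ((mdifferentiable_chart (I := 𝓘(𝕜, E)) p).mdifferentiableAt hq).hasMFDerivAt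
  have hlocal : HasMFDerivAt 𝓘(𝕜, E) 𝓘(𝕜, V) (z ∘ (chartAt E p).symm) (chartAt E p q)
      (mfderivInChart 𝕜 z p q : E →L[𝕜] V) :=
    (differentiableAt_comp_chartAt_symm hz hq).hasFDerivAt.hasMFDerivAt
  have heq : z =ᶠ[𝓝 q] (z ∘ (chartAt E p).symm) ∘ chartAt E p := by
    filter_upwards [(chartAt E p).open_source.mem_nhds hq] with r hr
    simp only [Function.comp_apply, (chartAt E p).left_inv hr]
  exact DFunLike.congr_fun ((hlocal.comp q hchart).congr_of_eventuallyEq heq).mfderiv v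

theorem exists_mfderiv_eq_mfderivInChart (hz : MDifferentiableAt 𝓘(𝕜, E) 𝓘(𝕜, V) z q)
    (hq : q ∈ (chartAt E p).source) (u : E) :
    ∃ v, mfderiv 𝓘(𝕜, E) 𝓘(𝕜, V) z q v = (mfderivInChart 𝕜 z p q : E →L[𝕜] V) u := by
  obtain ⟨v, hv⟩ := (mdifferentiable_chart (I := 𝓘(𝕜, E)) p).mfderiv_surjective hq u
  exact ⟨v, by rw [mfderiv_apply_eq_mfderivInChart hz hq, hv]⟩

theorem range_mfderivInChart (hz : MDifferentiableAt 𝓘(𝕜, E) 𝓘(𝕜, V) z q)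
    (hq : q ∈ (chartAt E p).source) :
    (mfderivInChart 𝕜 z p q : E →L[𝕜] V).range = (mfderiv 𝓘(𝕜, E) 𝓘(𝕜, V) z q).range := by
  refine le_antisymm ?_ ?_
  · rintro _ ⟨u, rfl⟩
    exact exists_mfderiv_eq_mfderivInChart hz hq u
  · rintro _ ⟨v, rfl⟩
    exact ⟨_, (mfderiv_apply_eq_mfderivInChart hz hq v).symm⟩

theorem isOpenMap_of_mfderiv_surjective [CompleteSpace E] [CompleteSpace V]
    (hz : ContMDiff 𝓘(𝕜, E) 𝓘(𝕜, V) 1 z)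
    (hsurj : ∀ p, Function.Surjective (mfderiv 𝓘(𝕜, E) 𝓘(𝕜, V) z p)) : IsOpenMap z := by
  refine IsOpenMap.of_nhds_le fun p => ?_
  set φ := chartAt E p
  have hp : p ∈ φ.source := mem_chart_source E p
  have hrange : (fderiv 𝕜 (z ∘ φ.symm) (φ p)).range = ⊤ := by
    refine (range_mfderivInChart ((hz p).mdifferentiableAt one_ne_zero) hp).trans ?_
    exact LinearMap.range_eq_top.2 (hsurj p)
  have hmap := ((contDiffAt_comp_chartAt_symm (hz p) hp).hasStrictFDerivAt
    one_ne_zero).map_nhds_eq_of_surj hrange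
  rw [Function.comp_apply, φ.left_inv hp, ← Filter.map_map] at hmap
  exact hmap.symm.trans_le (Filter.map_mono (φ.tendsto_symm hp))

theorem isOpenMap_of_mfderiv_injective [FiniteDimensional 𝕜 E] [FiniteDimensional 𝕜 V]
    (hdim : Module.finrank 𝕜 E = Module.finrank 𝕜 V) (hz : ContMDiff 𝓘(𝕜, E) 𝓘(𝕜, V) 1 z)
    (hinj : ∀ p, Function.Injective (mfderiv 𝓘(𝕜, E) 𝓘(𝕜, V) z p)) : IsOpenMap z :=
  have := FiniteDimensional.complete 𝕜 E
  have := FiniteDimensional.complete 𝕜 V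
  isOpenMap_of_mfderiv_surjective hz fun p =>
    (LinearMap.injective_iff_surjective_of_finrank_eq_finrank (V := E) (V₂ := V) hdim
      (f := (mfderiv 𝓘(𝕜, E) 𝓘(𝕜, V) z p).toLinearMap)).1 (hinj p)

end Charts

section RealCharts

variable {E V F G : Type*} [NormedAddCommGroup E] [NormedSpace ℝ E]
  [NormedAddCommGroup V] [NormedSpace ℝ V] [NormedAddCommGroup F] [NormedSpace ℝ F]
  [NormedAddCommGroup G] [NormedSpace ℝ G] {M : Type*} [TopologicalSpace M] [ChartedSpace E M]

theorem isLocallyConstant_of_mfderiv_eq_zero [IsManifold 𝓘(ℝ, E) 1 M] {z : M → V}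
    (hz : MDifferentiable 𝓘(ℝ, E) 𝓘(ℝ, V) z) (hz0 : ∀ q, mfderiv 𝓘(ℝ, E) 𝓘(ℝ, V) z q = 0) :
    IsLocallyConstant z := by
  refine (IsLocallyConstant.iff_eventually_eq z).2 fun p => ?_
  set φ := chartAt E p
  have hp : p ∈ φ.source := mem_chart_source E p
  have hdiff : DifferentiableOn ℝ (z ∘ φ.symm) φ.target := fun u hu => by
    have := differentiableAt_comp_chartAt_symm (p := p) (hz _) (φ.map_target hu)
    rw [φ.right_inv hu] at this
    exact this.differentiableWithinAt
  have hflat : φ.target.EqOn (fderiv ℝ (z ∘ φ.symm)) 0 := fun u hu => by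
    ext X
    obtain ⟨v, hv⟩ := exists_mfderiv_eq_mfderivInChart (p := p) (hz _) (φ.map_target hu) X
    rw [mfderivInChart, φ.right_inv hu, hz0] at hv
    exact hv.symm
  have hopen := φ.open_target.isOpen_inter_preimage_of_fderiv_eq_zero hdiff hflat {z p}
  have hmem : φ p ∈ φ.target ∩ (z ∘ φ.symm) ⁻¹' {z p} :=
    ⟨φ.map_source hp, congrArg z (φ.left_inv hp)⟩
  filter_upwards [φ.continuousAt hp (hopen.mem_nhds hmem), φ.open_source.mem_nhds hp]
    with q hq hqs
  exact (congrArg z (φ.left_inv hqs)).symm.trans hq.2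

theorem bilinear_fderiv_comm_of_eventually_eq_zero (B : V →L[ℝ] F →L[ℝ] G) {f : E → V} {g : E → F}
    {u : E} (hf : ContDiffAt ℝ 2 f u) (hg : DifferentiableAt ℝ g u)
    (hB : ∀ᶠ y in 𝓝 u, ∀ X, B (fderiv ℝ f y X) (g y) = 0) (X Y : E) :
    B (fderiv ℝ f u X) (fderiv ℝ g u Y) = B (fderiv ℝ f u Y) (fderiv ℝ g u X) := by
  have hf' : HasFDerivAt (fderiv ℝ f) (fderiv ℝ (fderiv ℝ f) u) u :=
    ((hf.fderiv_right (m := 1) (by norm_num)).differentiableAt one_ne_zero).hasFDerivAt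
  have hleibniz : ∀ X Y, B (fderiv ℝ f u X) (fderiv ℝ g u Y) =
      -B (fderiv ℝ (fderiv ℝ f) u Y X) (g u) := by
    intro X Y
    have hprod := B.hasFDerivAt_of_bilinear (hf'.clm_apply (hasFDerivAt_const X u)) hg.hasFDerivAt
    have hzero := hprod.unique ((hasFDerivAt_const (0 : G) u).congr_of_eventuallyEq
      (hB.mono fun y hy => hy X))
    refine eq_neg_of_add_eq_zero_left ?_
    simpa using DFunLike.congr_fun hzero Y
  have hsymm : IsSymmSndFDerivAt ℝ f u := hf.isSymmSndFDerivAt (by simp)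
  rw [hleibniz, hleibniz, hsymm.eq]

theorem bilinear_mfderiv_comm_of_eq_zero [IsManifold 𝓘(ℝ, E) 2 M] (B : V →L[ℝ] F →L[ℝ] G)
    {f : M → V} {g : M → F} (hf : ContMDiff 𝓘(ℝ, E) 𝓘(ℝ, V) 2 f)
    (hg : MDifferentiable 𝓘(ℝ, E) 𝓘(ℝ, F) g)
    (hB : ∀ q v, B (mfderiv 𝓘(ℝ, E) 𝓘(ℝ, V) f q v) (g q) = 0) (p : M)
    (v w : TangentSpace 𝓘(ℝ, E) p) :
    B (mfderiv 𝓘(ℝ, E) 𝓘(ℝ, V) f p v) (mfderiv 𝓘(ℝ, E) 𝓘(ℝ, F) g p w) =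
      B (mfderiv 𝓘(ℝ, E) 𝓘(ℝ, V) f p w) (mfderiv 𝓘(ℝ, E) 𝓘(ℝ, F) g p v) := by
  have : IsManifold 𝓘(ℝ, E) 1 M := .of_le (n := 2) one_le_two
  set φ := chartAt E p
  have hp : p ∈ φ.source := mem_chart_source E p
  have hfd := hf.mdifferentiable two_ne_zero
  have hBφ : ∀ᶠ y in 𝓝 (φ p), ∀ X, B (fderiv ℝ (f ∘ φ.symm) y X) ((g ∘ φ.symm) y) = 0 := by
    filter_upwards [φ.open_target.mem_nhds (φ.map_source hp)] with y hy X
    obtain ⟨v, hv⟩ := exists_mfderiv_eq_mfderivInChart (p := p) (hfd _) (φ.map_target hy) X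
    rw [mfderivInChart, φ.right_inv hy] at hv
    exact hv ▸ hB _ v
  simp only [mfderiv_apply_eq_mfderivInChart (hfd p) hp,
    mfderiv_apply_eq_mfderivInChart (hg p) hp]
  exact bilinear_fderiv_comm_of_eventually_eq_zero B (contDiffAt_comp_chartAt_symm (hf p) hp)
    (differentiableAt_comp_chartAt_symm (hg p) hp) hBφ _ _

end RealCharts

section Projections

open ContinuousLinearMap Module
open scoped InnerProduct InnerProductSpace

section KerOrthogonal

variable {𝕜 E V : Type*} [RCLike 𝕜] [NormedAddCommGroup E] [InnerProductSpace 𝕜 E]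
  [NormedAddCommGroup V] [NormedSpace 𝕜 V]

theorem finrank_ker_orthogonal [FiniteDimensional 𝕜 E] (A : E →L[𝕜] V) :
    finrank 𝕜 A.kerᗮ = finrank 𝕜 A.range := by
  have hker := A.ker.finrank_add_finrank_orthogonal
  have hrank := A.toLinearMap.finrank_range_add_finrank_ker
  lia

theorem injective_comp_ker_orthogonal_subtypeL (A : E →L[𝕜] V) :
    Function.Injective (A ∘L A.kerᗮ.subtypeL) := by
  have hdisj : Disjoint A.kerᗮ A.ker := A.ker.orthogonal_disjoint.symm
  exact Set.injOn_iff_injective.1 (LinearMap.disjoint_ker_iff_injOn.1 hdisj)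

end KerOrthogonal

theorem starProjection_range_of_isUnit {𝕜 E V : Type*} [RCLike 𝕜]
    [NormedAddCommGroup E] [InnerProductSpace 𝕜 E] [CompleteSpace E]
    [NormedAddCommGroup V] [InnerProductSpace 𝕜 V] [CompleteSpace V] {C : E →L[𝕜] V}
    [C.range.HasOrthogonalProjection] (hC : IsUnit (C† ∘L C)) :
    C.range.starProjection = C ∘L Ring.inverse (C† ∘L C) ∘L C† := by
  ext x
  refine Submodule.eq_starProjection_of_mem_orthogonal ⟨_, rfl⟩ ?_
  have hinv := DFunLike.congr_fun (Ring.mul_inverse_cancel _ hC) ((C†) x)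
  rw [orthogonal_range, LinearMap.mem_ker]
  exact (map_sub _ _ _).trans (sub_eq_zero.2 hinv.symm)

variable {E V : Type*} [NormedAddCommGroup E] [InnerProductSpace ℝ E] [FiniteDimensional ℝ E]
  [NormedAddCommGroup V] [InnerProductSpace ℝ V] [FiniteDimensional ℝ V]

theorem isUnit_adjoint_comp_self {C : E →L[ℝ] V} (hC : Function.Injective C) :
    IsUnit (C† ∘L C) := by
  have hinj : Function.Injective (C† ∘L C) := C.adjoint_comp_self_injective_iff.2 hC
  rw [isUnit_iff_bijective]
  exact ⟨hinj, LinearMap.injective_iff_surjective.1 hinj⟩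

theorem contDiff_adjoint {k : ℕ∞ω} : ContDiff ℝ k fun C : E →L[ℝ] V => C† :=
  IsBoundedLinearMap.contDiff
    ⟨⟨map_add _, fun c C => by simp⟩, 1, one_pos, fun C => by simp⟩

theorem contDiffAt_starProjection_range_of_injective {k : ℕ∞ω} {C : E →L[ℝ] V}
    (hC : Function.Injective C) :
    ContDiffAt ℝ k (fun D : E →L[ℝ] V => D.range.starProjection) C := by
  obtain ⟨u, hu⟩ := isUnit_adjoint_comp_self hC
  have hgram : ContDiff ℝ k fun D : E →L[ℝ] V => D† ∘L D := contDiff_adjoint.clm_comp contDiff_id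
  have hinverse : ContDiffAt ℝ k (fun D : E →L[ℝ] V => Ring.inverse (D† ∘L D)) C :=
    ContDiffAt.comp (g := Ring.inverse) C (hu ▸ contDiffAt_ringInverse ℝ u) hgram.contDiffAt
  refine (contDiffAt_id.clm_comp (hinverse.clm_comp
    contDiff_adjoint.contDiffAt)).congr_of_eventuallyEq ?_
  filter_upwards [isOpen_injective.mem_nhds hC] with D hD
  exact starProjection_range_of_isUnit (isUnit_adjoint_comp_self hD)

variable {F : Type*} [NormedAddCommGroup F] [NormedSpace ℝ F] {H : Type*} [TopologicalSpace H]
  {I : ModelWithCorners ℝ F H} {M : Type*} [TopologicalSpace M] [ChartedSpace H M] {p : M}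

theorem contMDiffAt_starProjection_range {k : ℕ∞ω} {A : M → E →L[ℝ] V}
    (hA : ContMDiffAt I 𝓘(ℝ, E →L[ℝ] V) k A p)
    (hrank : ∀ᶠ q in 𝓝 p, finrank ℝ (A q).range = finrank ℝ (A p).range) :
    ContMDiffAt I 𝓘(ℝ, V →L[ℝ] V) k (fun q => (A q).range.starProjection) p := by
  let ι := (A p).kerᗮ.subtypeL
  have hinj : Function.Injective (A p ∘L ι) := injective_comp_ker_orthogonal_subtypeL (A p)
  have hC : ContMDiffAt I 𝓘(ℝ, (A p).kerᗮ →L[ℝ] V) k (fun q => A q ∘L ι) p :=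
    hA.clm_comp contMDiffAt_const
  have hrange : ∀ᶠ q in 𝓝 p, (A q ∘L ι).range = (A q).range := by
    filter_upwards [hrank, hC.continuousAt (isOpen_injective.mem_nhds hinj)] with q hq hinjq
    refine Submodule.eq_of_le_of_finrank_eq (LinearMap.range_comp_le_range _ _) ?_
    exact (LinearMap.finrank_range_of_inj hinjq).trans
      ((finrank_ker_orthogonal (A p)).trans hq.symm)
  refine (ContDiffAt.comp_contMDiffAt (f := fun q => A q ∘L ι)
    (contDiffAt_starProjection_range_of_injective hinj) hC).congr_of_eventuallyEq ?_
  filter_upwards [hrange] with q hq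
  simp only [Function.comp_apply, hq]

theorem hasMFDerivAt_isStarProjection_eq_zero {𝔸 : Type*} [NormedRing 𝔸] [NormedAlgebra ℝ 𝔸]
    [StarRing 𝔸] [StarModule ℝ 𝔸] [ContinuousStar 𝔸] {P : M → 𝔸}
    {P' : TangentSpace I p →L[ℝ] 𝔸} (hP : ∀ q, IsStarProjection (P q))
    (hderiv : HasMFDerivAt I 𝓘(ℝ, 𝔸) P p P') (h0 : ∀ v, P p * P' v = 0) : P' = 0 := by
  have hmul : P * P = P := funext fun q => (hP q).isIdempotentElem
  have hstar : starL' ℝ ∘ P = P := funext fun q => (hP q).isSelfAdjoint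
  have hderiv_mul := hderiv.mul' hderiv
  have hderiv_star := (starL' ℝ (A := 𝔸)).hasMFDerivAt.comp p hderiv
  rw [hmul] at hderiv_mul
  rw [hstar] at hderiv_star
  ext v
  have hmul' : P' v = P p * P' v + P' v * P p :=
    DFunLike.congr_fun (hasMFDerivAt_unique hderiv hderiv_mul) v
  have hstar' : P' v = star (P' v) := DFunLike.congr_fun (hasMFDerivAt_unique hderiv hderiv_star) v
  calc P' v = P' v * P p := by simpa only [h0, zero_add] using hmul'
    _ = star (P p * P' v) := by rw [star_mul, (hP p).isSelfAdjoint.star_eq, ← hstar']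
    _ = 0 := by rw [h0, star_zero]

end Projections

theorem mem_orthogonal_iff_inner_complex_eq_zero {n : ℕ}
    {W : Submodule ℝ (EuclideanSpace ℂ (Fin n))} (hW : ∀ w ∈ W, Complex.I • w ∈ W)
    {c : EuclideanSpace ℂ (Fin n)} : c ∈ Wᗮ ↔ ∀ w ∈ W, inner ℂ w c = 0 := by
  have hre : ∀ w, inner ℝ w c = (inner ℂ w c).re := fun w => by simp [PiLp.inner_apply]
  simp only [Submodule.mem_orthogonal, hre]
  refine ⟨fun h w hw => Complex.ext (h w hw) ?_, fun h w hw => by rw [h w hw, Complex.zero_re]⟩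
  simpa [inner_smul_left] using h _ (hW w hw)

theorem exists_orthonormalBasis_inner_eq_zero {𝕜 V : Type*} [RCLike 𝕜] [NormedAddCommGroup V]
    [InnerProductSpace 𝕜 V] [FiniteDimensional 𝕜 V] {n : ℕ} (hn : Module.finrank 𝕜 V = n)
    (K : Submodule 𝕜 V) :
    ∃ b : OrthonormalBasis (Fin n) 𝕜 V,
      ∀ w ∈ K, ∀ β : Fin n, Module.finrank 𝕜 K ≤ β → inner 𝕜 (b β) w = 0 := by
  let c := stdOrthonormalBasis 𝕜 K
  let s : Set (Fin n) := {i | (i : ℕ) < Module.finrank 𝕜 K}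
  let v : Fin n → V := fun i => if h : (i : ℕ) < Module.finrank 𝕜 K then c ⟨i, h⟩ else 0
  have hv : ∀ i (hi : i ∈ s), v i = c ⟨i, hi⟩ := fun i hi => dif_pos hi
  have hortho : Orthonormal 𝕜 (s.domRestrict v) := by
    have hc := (c.orthonormal.comp_linearIsometry K.subtypeₗᵢ).comp
      (fun i : s => (⟨i, i.2⟩ : Fin (Module.finrank 𝕜 K)))
      fun i j hij => Subtype.ext (Fin.ext (Fin.mk.inj hij))
    exact (funext fun i : s => hv i i.2 : s.domRestrict v = _) ▸ hc
  obtain ⟨b, hb⟩ := hortho.exists_orthonormalBasis_extension_of_card_eq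
    (hn.trans (Fintype.card_fin n).symm)
  refine ⟨b, fun w hw β hβ => ?_⟩
  have hbc : ∀ j, inner 𝕜 (b β) (c j : V) = 0 := fun j => by
    have hjn : (j : ℕ) < n := j.2.trans_le (K.finrank_le.trans hn.le)
    rw [← hv ⟨j, hjn⟩ j.2, ← hb _ j.2]
    exact b.orthonormal.2 fun h => (j.2.trans_le hβ).ne' (congrArg Fin.val h)
  have hsum : w = ∑ j, c.repr ⟨w, hw⟩ j • (c j : V) := by
    simpa using congrArg K.subtype (c.sum_repr ⟨w, hw⟩).symm
  rw [hsum, inner_sum]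
  exact Finset.sum_eq_zero fun j _ => by rw [inner_smul_right, hbc, mul_zero]

open Matrix in
theorem exists_unitary_mulVec_eq_zero {𝕜 : Type*} [RCLike 𝕜] {n : ℕ}
    (K : Submodule 𝕜 (EuclideanSpace 𝕜 (Fin n))) :
    ∃ U : unitaryGroup (Fin n) 𝕜, ∀ w ∈ K, ∀ β : Fin n, Module.finrank 𝕜 K ≤ β →
      ((U : Matrix (Fin n) (Fin n) 𝕜) *ᵥ w) β = 0 := by
  obtain ⟨b, hb⟩ := exists_orthonormalBasis_inner_eq_zero finrank_euclideanSpace_fin K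
  let e := EuclideanSpace.basisFun (Fin n) 𝕜
  refine ⟨⟨b.toBasis.toMatrix e, b.toMatrix_orthonormalBasis_mem_unitary e⟩,
    fun w hw β hβ => ?_⟩
  have hrepr := congrFun (e.toBasis.toMatrix_mulVec_repr b.toBasis w) β
  rw [b.coe_toBasis_repr_apply, b.repr_apply_apply, hb w hw β hβ] at hrepr
  exact hrepr

namespace Heisenberg

open Matrix

variable {n : ℕ}

theorem sum_im_mul_re_sub (a b : Fin n → ℂ) :
    ∑ β, ((a β).im * (b β).re - (a β).re * (b β).im) = -(star a ⬝ᵥ b).im := by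
  simp only [dotProduct, Complex.im_sum, ← Finset.sum_neg_distrib, Pi.star_apply, RCLike.star_def,
    Complex.mul_im, Complex.conj_re, Complex.conj_im]
  exact Finset.sum_congr rfl fun β _ => by ring

theorem contactForm_eq_add_im (q v : Heisenberg n) :
    contactForm q v = v.2 + (star q.1 ⬝ᵥ v.1).im := by
  rw [contactForm, ← neg_neg (star q.1 ⬝ᵥ v.1).im, ← sum_im_mul_re_sub, ← Finset.sum_neg_distrib]
  simp only [neg_sub]

theorem horizontalLift_eq (q : Heisenberg n) (w : Fin n → ℂ) :
    horizontalLift q w = (w, -(star q.1 ⬝ᵥ w).im) := by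
  rw [horizontalLift, sum_im_mul_re_sub]

theorem leftTranslation_eq (p q : Heisenberg n) :
    leftTranslation p q = (p.1 + q.1, p.2 + q.2 - (star p.1 ⬝ᵥ q.1).im) := by
  rw [leftTranslation, sum_im_mul_re_sub, sub_eq_add_neg]

theorem contactForm_add (q v w : Heisenberg n) :
    contactForm q (v + w) = contactForm q v + contactForm q w := by
  simp only [contactForm_eq_add_im, Prod.fst_add, Prod.snd_add, dotProduct_add, Complex.add_im]
  ring

theorem contactForm_smul (q v : Heisenberg n) (c : ℝ) :
    contactForm q (c • v) = c * contactForm q v := by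
  simp [contactForm_eq_add_im, dotProduct_smul, mul_add]

theorem contactForm_reeb (q : Heisenberg n) : contactForm q reeb = 1 := by
  simp [contactForm_eq_add_im, reeb]

theorem levi_eq_inner (c d : EuclideanSpace ℂ (Fin n)) : levi c d = inner ℂ d c := rfl

theorem star_mulVec_dotProduct_mulVec (U : unitaryGroup (Fin n) ℂ) (a b : Fin n → ℂ) :
    star ((U : Matrix (Fin n) (Fin n) ℂ) *ᵥ a) ⬝ᵥ ((U : Matrix (Fin n) (Fin n) ℂ) *ᵥ b) =
      star a ⬝ᵥ b := by
  rw [star_mulVec, dotProduct_mulVec, vecMul_vecMul, ← star_eq_conjTranspose,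
    Unitary.coe_star_mul_self, vecMul_one]

theorem star_dotProduct_self_im (a : Fin n → ℂ) : (star a ⬝ᵥ a).im = 0 := by
  rw [← neg_eq_zero, ← sum_im_mul_re_sub]
  exact Finset.sum_eq_zero fun β _ => by ring

/-- The projection `(z, t) ↦ z` onto `ℂⁿ` with its standard Hermitian inner product, whose kernel
is spanned by the Reeb field. -/
noncomputable def horizontalPart (n : ℕ) : Heisenberg n →L[ℝ] EuclideanSpace ℂ (Fin n) :=
  ((PiLp.continuousLinearEquiv 2 ℝ fun _ : Fin n => ℂ).symm : (Fin n → ℂ) →L[ℝ] _) ∘L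
    ContinuousLinearMap.fst ℝ (Fin n → ℂ) ℝ

theorem horizontalPart_eq_zero_iff {n : ℕ} {q : Heisenberg n} :
    horizontalPart n q = 0 ↔ q = q.2 • reeb := by
  refine ⟨fun h => ?_, fun h => ?_⟩
  · have hz : q.1 = 0 := congrArg WithLp.ofLp h
    ext : 1
    · simp [hz, reeb]
    · simp [reeb]
  · rw [h, map_smul]
    exact smul_zero _

/-- The linear part of the affine map `L_p ∘ Φ_U`, where `p = (a, t)`. -/
noncomputable def rigidMotionLinear (a : Fin n → ℂ) (U : unitaryGroup (Fin n) ℂ) :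
    Heisenberg n →L[ℝ] Heisenberg n :=
  LinearMap.toContinuousLinearMap
    { toFun := fun q => ((U : Matrix (Fin n) (Fin n) ℂ) *ᵥ q.1,
        q.2 - (star a ⬝ᵥ ((U : Matrix (Fin n) (Fin n) ℂ) *ᵥ q.1)).im)
      map_add' := fun q r => by
        ext
        · simp [mulVec_add]
        · simp only [Prod.snd_add, Prod.fst_add, mulVec_add, dotProduct_add, Complex.add_im]
          ring
      map_smul' := fun c q => by
        ext
        · simp [mulVec_smul]
        · simp [mulVec_smul, dotProduct_smul, mul_sub] }

theorem rigidMotionLinear_apply (a : Fin n → ℂ) (U : unitaryGroup (Fin n) ℂ) (q : Heisenberg n) :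
    rigidMotionLinear a U q = ((U : Matrix (Fin n) (Fin n) ℂ) *ᵥ q.1,
      q.2 - (star a ⬝ᵥ ((U : Matrix (Fin n) (Fin n) ℂ) *ᵥ q.1)).im) := rfl

theorem leftTranslation_rotation (p q : Heisenberg n) (U : unitaryGroup (Fin n) ℂ) :
    leftTranslation p (rotation U q) = p + rigidMotionLinear p.1 U q := by
  rw [leftTranslation_eq, rigidMotionLinear_apply, rotation, ← add_sub_assoc']
  rfl

theorem rotation_star_rotation (U : unitaryGroup (Fin n) ℂ) (q : Heisenberg n) :
    rotation (star U) (rotation U q) = q := by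
  simp [rotation]

theorem leftTranslation_neg_leftTranslation (p q : Heisenberg n) :
    leftTranslation (-p) (leftTranslation p q) = q := by
  ext : 1
  · simp [leftTranslation_eq]
  · simp only [leftTranslation_eq, Prod.fst_neg, Prod.snd_neg, star_neg, neg_dotProduct,
      dotProduct_add, Complex.neg_im, Complex.add_im, star_dotProduct_self_im]
    ring

/-- The rigid motion `L_p ∘ Φ_U`. -/
noncomputable def rigidMotion (p : Heisenberg n) (U : unitaryGroup (Fin n) ℂ) :
    Heisenberg n ≃ Heisenberg n where
  toFun q := leftTranslation p (rotation U q)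
  invFun q := rotation (star U) (leftTranslation (-p) q)
  left_inv q := by simp only [leftTranslation_neg_leftTranslation, rotation_star_rotation]
  right_inv q := by
    have hrotation := rotation_star_rotation (star U) (leftTranslation (-p) q)
    have htranslation := leftTranslation_neg_leftTranslation (-p) q
    rw [star_star] at hrotation
    rw [neg_neg] at htranslation
    simp only [hrotation, htranslation]

theorem coe_rigidMotion (p : Heisenberg n) (U : unitaryGroup (Fin n) ℂ) :
    ⇑(rigidMotion p U) = fun q => p + rigidMotionLinear p.1 U q :=
  funext fun q => leftTranslation_rotation p q U

theorem coe_rigidMotion_symm (p : Heisenberg n) (U : unitaryGroup (Fin n) ℂ) :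
    ⇑(rigidMotion p U).symm =
      fun q => rigidMotionLinear 0 (star U) (-p + rigidMotionLinear (-p).1 1 q) := by
  funext q
  change rotation (star U) (leftTranslation (-p) q) = _
  rw [← leftTranslation_rotation, rigidMotionLinear_apply]
  simp [rotation]

theorem hasFDerivAt_rigidMotion (p : Heisenberg n) (U : unitaryGroup (Fin n) ℂ)
    (q : Heisenberg n) : HasFDerivAt (rigidMotion p U) (rigidMotionLinear p.1 U) q := by
  rw [coe_rigidMotion]
  exact (rigidMotionLinear p.1 U).hasFDerivAt.const_add p

theorem contDiff_rigidMotion (p : Heisenberg n) (U : unitaryGroup (Fin n) ℂ) :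
    ContDiff ℝ ∞ (rigidMotion p U) := by
  rw [coe_rigidMotion]
  exact contDiff_const.add (rigidMotionLinear p.1 U).contDiff

theorem contDiff_rigidMotion_symm (p : Heisenberg n) (U : unitaryGroup (Fin n) ℂ) :
    ContDiff ℝ ∞ (rigidMotion p U).symm := by
  rw [coe_rigidMotion_symm]
  exact (rigidMotionLinear _ _).contDiff.comp (contDiff_const.add (rigidMotionLinear _ _).contDiff)

theorem contactForm_rigidMotion (p : Heisenberg n) (U : unitaryGroup (Fin n) ℂ)
    (q v : Heisenberg n) :
    contactForm (rigidMotion p U q) (rigidMotionLinear p.1 U v) = contactForm q v := by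
  simp only [coe_rigidMotion, rigidMotionLinear_apply, contactForm_eq_add_im, Prod.fst_add,
    star_add, add_dotProduct, star_mulVec_dotProduct_mulVec, Complex.add_im]
  ring

theorem rigidMotionLinear_injective (a : Fin n → ℂ) (U : unitaryGroup (Fin n) ℂ) :
    Function.Injective (rigidMotionLinear a U) := by
  have hcomp : ⇑(rigidMotionLinear a U) = (-(a, 0) + ·) ∘ rigidMotion (a, 0) U := by
    funext q
    rw [coe_rigidMotion, Function.comp_apply, neg_add_cancel_left]
  rw [hcomp]
  exact (add_right_injective _).comp (rigidMotion (a, 0) U).injective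

theorem rigidMotionLinear_complexStructure (p : Heisenberg n) (U : unitaryGroup (Fin n) ℂ)
    (q v : Heisenberg n) :
    rigidMotionLinear p.1 U (complexStructure q v) =
      complexStructure (rigidMotion p U q) (rigidMotionLinear p.1 U v) := by
  simp only [coe_rigidMotion, complexStructure, horizontalLift_eq, rigidMotionLinear_apply]
  ext : 1
  · simp only [mulVec_smul]
  · simp only [Prod.fst_add, star_add, add_dotProduct, mulVec_smul, dotProduct_smul,
      star_mulVec_dotProduct_mulVec, smul_add, Complex.add_im]
    ring

theorem isRigidMotion_rigidMotion (p : Heisenberg n) (U : unitaryGroup (Fin n) ℂ) :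
    IsRigidMotion (rigidMotion p U) := by
  refine ⟨⟨contDiff_rigidMotion p U, contDiff_rigidMotion_symm p U, fun q v => ?_,
    fun q v _ => ?_⟩, p, U, fun q => rfl⟩
  · rw [(hasFDerivAt_rigidMotion p U q).fderiv, contactForm_rigidMotion]
  · rw [(hasFDerivAt_rigidMotion p U q).fderiv, rigidMotionLinear_complexStructure]

/-- The Heisenberg subgroup `H_m = {z_{m+1} = ⋯ = z_n = 0}` of `H_n`. It is all of `H_n` when
`n ≤ m`. -/
def coordinateSubgroup (m n : ℕ) : Set (Heisenberg n) := {q | ∀ β : Fin n, m ≤ β → q.1 β = 0}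

theorem coordinateSubgroup_succ (m : ℕ) : coordinateSubgroup m (m + 1) = subgroup m := by
  ext q
  refine ⟨fun hq => hq _ le_rfl, fun hq β hβ => ?_⟩
  rwa [show β = Fin.last m from Fin.ext (le_antisymm (Nat.lt_succ_iff.1 β.2) hβ)]

/-- The projection of `H_n` onto `H_m` that forgets the coordinates `z_{m+1}, …, z_n`. -/
noncomputable def forget {m n : ℕ} (h : m ≤ n) : Heisenberg n →L[ℝ] Heisenberg m :=
  (ContinuousLinearMap.pi fun β => ContinuousLinearMap.proj (R := ℝ) (φ := fun _ : Fin n => ℂ)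
    (Fin.castLE h β) ∘L ContinuousLinearMap.fst ℝ (Fin n → ℂ) ℝ).prod
    (ContinuousLinearMap.snd ℝ (Fin n → ℂ) ℝ)

theorem injOn_forget {m n : ℕ} (h : m ≤ n) : (coordinateSubgroup m n).InjOn (forget h) := by
  intro q hq r hr hqr
  refine Prod.ext (funext fun β => ?_) (Prod.ext_iff.1 hqr).2
  obtain hβ | hβ := lt_or_ge (β : ℕ) m
  · exact congrFun (Prod.ext_iff.1 hqr).1 ⟨β, hβ⟩
  · rw [hq β hβ, hr β hβ]

theorem finrank_real_heisenberg (n : ℕ) : Module.finrank ℝ (Heisenberg n) = 2 * n + 1 := by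
  simp [Module.finrank_pi_fintype, Complex.finrank_real_complex, mul_comm]

end Heisenberg

namespace PseudohermitianSubmanifold

open Heisenberg Module

variable {m n : ℕ} {M : Type*} [TopologicalSpace M]
  [ChartedSpace (EuclideanSpace ℝ (Fin (2 * m + 1))) M] (S : PseudohermitianSubmanifold m n M)

/-- The coordinate map `z : M → ℂⁿ`, where `ℂⁿ` carries the inner product that represents the Levi
metric. -/
noncomputable def zMap (p : M) : EuclideanSpace ℂ (Fin n) := horizontalPart n (S.toFun p)

/-- The differential of `z` at `p`. On `ξ̂_p` it gives the coefficients `holPart`. -/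
noncomputable def dz (p : M) :
    TangentSpace (𝓡 (2 * m + 1)) p →L[ℝ] EuclideanSpace ℂ (Fin n) :=
  horizontalPart n ∘L tangentMapAt m S.toFun p

/-- The image of `dz` at `p`. If `M` is vertical, it is already the image of `ξ̂_p`, hence a complex
subspace, and its orthogonal complement consists of the coefficients of the normal vectors. -/
noncomputable def horizontalImage (p : M) : Submodule ℝ (EuclideanSpace ℂ (Fin n)) :=
  (S.dz p).range

theorem contMDiff_zMap :
    ContMDiff (𝓡 (2 * m + 1)) 𝓘(ℝ, EuclideanSpace ℂ (Fin n)) ∞ S.zMap :=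
  (horizontalPart n).contDiff.contMDiff.comp S.smooth

theorem mfderiv_zMap (p : M) :
    mfderiv (𝓡 (2 * m + 1)) 𝓘(ℝ, EuclideanSpace ℂ (Fin n)) S.zMap p = S.dz p :=
  ((horizontalPart n).hasMFDerivAt.comp p
    ((S.smooth p).mdifferentiableAt (by simp)).hasMFDerivAt).mfderiv

theorem dz_J (p : M) (y : contactPlane m S.toFun p) :
    S.dz p (S.J p y) = Complex.I • S.dz p y := by
  rw [dz, ContinuousLinearMap.comp_apply, S.J_eq]
  rfl

variable {S}

theorem IsVertical.exists_tangentMapAt_eq_reeb (hS : S.IsVertical) (p : M) :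
    ∃ T, tangentMapAt m S.toFun p T = reeb := by
  obtain ⟨-, T, hT⟩ := hS p
  refine ⟨T, hT.trans ?_⟩
  simp [horizontalLift_eq]

theorem dz_eq_zero_of_tangentMapAt_eq_reeb {p : M} {T : TangentSpace (𝓡 (2 * m + 1)) p}
    (hT : tangentMapAt m S.toFun p T = reeb) : S.dz p T = 0 := by
  rw [dz, ContinuousLinearMap.comp_apply, hT]
  rfl

theorem IsVertical.exists_contact_dz_eq (hS : S.IsVertical) (p : M)
    (v : TangentSpace (𝓡 (2 * m + 1)) p) :
    ∃ y : contactPlane m S.toFun p, S.dz p y = S.dz p v := by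
  obtain ⟨T, hT⟩ := hS.exists_tangentMapAt_eq_reeb p
  have hcontact : v + (-inducedForm m S.toFun p v) • T ∈ contactPlane m S.toFun p := by
    change contactForm _ _ = 0
    rw [map_add, map_smul, contactForm_add, contactForm_smul, hT, contactForm_reeb, mul_one]
    exact add_neg_cancel _
  refine ⟨⟨_, hcontact⟩, ?_⟩
  rw [map_add, map_smul, dz_eq_zero_of_tangentMapAt_eq_reeb hT, smul_zero, add_zero]

theorem IsVertical.I_smul_mem_horizontalImage (hS : S.IsVertical) {p : M}
    {w : EuclideanSpace ℂ (Fin n)} (hw : w ∈ S.horizontalImage p) :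
    Complex.I • w ∈ S.horizontalImage p := by
  obtain ⟨v, rfl⟩ := hw
  obtain ⟨y, hy⟩ := hS.exists_contact_dz_eq p v
  exact ⟨S.J p y, (S.dz_J p y).trans (congrArg _ hy)⟩

theorem IsVertical.ker_dz (hS : S.IsVertical) (p : M) :
    ∃ T ≠ 0, (S.dz p).ker = ℝ ∙ T := by
  obtain ⟨T, hT⟩ := hS.exists_tangentMapAt_eq_reeb p
  refine ⟨T, ?_, ?_⟩
  · rintro rfl
    simpa [reeb] using congrArg Prod.snd hT
  · ext v
    rw [Submodule.mem_span_singleton]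
    refine ⟨fun hv => ⟨(tangentMapAt m S.toFun p v).2, S.immersion p ?_⟩, ?_⟩
    · rw [map_smul, hT]
      exact (horizontalPart_eq_zero_iff.1 hv).symm
    · rintro ⟨c, rfl⟩
      exact Submodule.smul_mem _ c (dz_eq_zero_of_tangentMapAt_eq_reeb hT)

theorem IsVertical.finrank_horizontalImage (hS : S.IsVertical) (p : M) :
    finrank ℝ (S.horizontalImage p) = 2 * m := by
  obtain ⟨T, hT, hker⟩ := hS.ker_dz p
  have hdim : finrank ℝ (TangentSpace (𝓡 (2 * m + 1)) p) = 2 * m + 1 :=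
    finrank_euclideanSpace_fin
  have : FiniteDimensional ℝ (TangentSpace (𝓡 (2 * m + 1)) p) :=
    inferInstanceAs (FiniteDimensional ℝ (EuclideanSpace ℝ (Fin (2 * m + 1))))
  have hrank := (S.dz p).toLinearMap.finrank_range_add_finrank_ker
  rw [hker, finrank_span_singleton hT, hdim] at hrank
  exact Nat.succ_injective hrank

/-- The image of `dz` at a point of a vertical submanifold, as a complex subspace; its dimension is
the CR dimension. -/
noncomputable def IsVertical.complexHorizontalImage (hS : S.IsVertical) (p : M) :
    Submodule ℂ (EuclideanSpace ℂ (Fin n)) :=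
  { S.horizontalImage p with
    smul_mem' := fun c w hw => by
      have hsum : c • w = c.re • w + c.im • Complex.I • w := by
        rw [← Complex.coe_smul, ← Complex.coe_smul, smul_smul, ← add_smul, Complex.re_add_im]
      rw [hsum]
      exact add_mem (Submodule.smul_mem _ _ hw)
        (Submodule.smul_mem _ _ (hS.I_smul_mem_horizontalImage hw)) }

theorem IsVertical.finrank_complexHorizontalImage (hS : S.IsVertical) (p : M) :
    finrank ℂ (hS.complexHorizontalImage p) = m := by
  have hreal := finrank_real_of_complex (hS.complexHorizontalImage p)
  exact mul_left_cancel₀ two_ne_zero (hreal.symm.trans (hS.finrank_horizontalImage p))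

theorem IsVertical.dim_le (hS : S.IsVertical) [Nonempty M] : m ≤ n := by
  obtain ⟨p⟩ := ‹Nonempty M›
  exact (hS.finrank_complexHorizontalImage p).symm.trans_le
    ((Submodule.finrank_le _).trans finrank_euclideanSpace_fin.le)

theorem IsVertical.mem_orthogonal_horizontalImage_iff (hS : S.IsVertical) {p : M}
    {c : EuclideanSpace ℂ (Fin n)} :
    c ∈ (S.horizontalImage p)ᗮ ↔ ∀ v, inner ℂ (S.dz p v) c = 0 := by
  rw [mem_orthogonal_iff_inner_complex_eq_zero
    fun w hw => hS.I_smul_mem_horizontalImage hw]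
  exact Set.forall_mem_range

theorem IsVertical.isNormalAt (hS : S.IsVertical) {p : M}
    {c : EuclideanSpace ℂ (Fin n)} (hc : c ∈ (S.horizontalImage p)ᗮ) : S.IsNormalAt p c := by
  intro v
  refine (levi_eq_inner (S.dz p v) c).trans ?_
  exact inner_eq_zero_symm.1 (hS.mem_orthogonal_horizontalImage_iff.1 hc v)

variable {N : M → EuclideanSpace ℂ (Fin n)}

theorem IsVertical.isNormalFieldOn_univ (hS : S.IsVertical)
    (hN : ContMDiff (𝓡 (2 * m + 1)) 𝓘(ℝ, EuclideanSpace ℂ (Fin n)) ∞ N)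
    (hnormal : ∀ q, N q ∈ (S.horizontalImage q)ᗮ) :
    S.IsNormalFieldOn Set.univ fun q => (N q).ofLp :=
  ⟨((PiLp.continuousLinearEquiv 2 ℝ fun _ : Fin n => ℂ).contDiff.contMDiff.comp hN).contMDiffOn,
    fun q _ => hS.isNormalAt (hnormal q)⟩

variable {p : M} {N' : TangentSpace (𝓡 (2 * m + 1)) p →L[ℝ] EuclideanSpace ℂ (Fin n)}

theorem covDeriv_ofLp
    (hN' : HasMFDerivAt (𝓡 (2 * m + 1)) 𝓘(ℝ, EuclideanSpace ℂ (Fin n)) N p N')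
    (v : TangentSpace (𝓡 (2 * m + 1)) p) :
    covDeriv (m := m) (fun q => (N q).ofLp) p v = (N' v).ofLp :=
  DFunLike.congr_fun
    ((PiLp.continuousLinearEquiv 2 ℝ fun _ : Fin n => ℂ).hasMFDerivAt.comp p hN').mfderiv v

variable [IsManifold (𝓡 (2 * m + 1)) ∞ M]

theorem IsVertical.inner_dz_comm (hS : S.IsVertical)
    (hN : MDifferentiable (𝓡 (2 * m + 1)) 𝓘(ℝ, EuclideanSpace ℂ (Fin n)) N)
    (hnormal : ∀ q, N q ∈ (S.horizontalImage q)ᗮ)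
    (hN' : HasMFDerivAt (𝓡 (2 * m + 1)) 𝓘(ℝ, EuclideanSpace ℂ (Fin n)) N p N')
    (v w : TangentSpace (𝓡 (2 * m + 1)) p) :
    inner ℂ (S.dz p v) (N' w) = inner ℂ (S.dz p w) (N' v) := by
  have h2 : (2 : ℕ∞ω) ≤ ∞ := WithTop.coe_le_coe.2 le_top
  have : IsManifold (𝓡 (2 * m + 1)) 2 M := .of_le (n := ∞) h2
  let B : EuclideanSpace ℂ (Fin n) →L[ℝ] EuclideanSpace ℂ (Fin n) →L[ℝ] ℂ :=
    (isBoundedBilinearMap_inner (𝕜 := ℂ)).toContinuousLinearMap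
  have hcomm := bilinear_mfderiv_comm_of_eq_zero B (S.contMDiff_zMap.of_le h2) hN
    (fun q u => S.mfderiv_zMap q ▸ hS.mem_orthogonal_horizontalImage_iff.1 (hnormal q) u) p v w
  rwa [mfderiv_zMap, hN'.mfderiv] at hcomm

theorem SecondFundamentalFormVanishes.mem_orthogonal_horizontalImage
    (hII : S.SecondFundamentalFormVanishes) (hS : S.IsVertical)
    (hN : ContMDiff (𝓡 (2 * m + 1)) 𝓘(ℝ, EuclideanSpace ℂ (Fin n)) ∞ N)
    (hnormal : ∀ q, N q ∈ (S.horizontalImage q)ᗮ)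
    (hN' : HasMFDerivAt (𝓡 (2 * m + 1)) 𝓘(ℝ, EuclideanSpace ℂ (Fin n)) N p N')
    (v : TangentSpace (𝓡 (2 * m + 1)) p) : N' v ∈ (S.horizontalImage p)ᗮ := by
  have hcomm := hS.inner_dz_comm (hN.mdifferentiable (by simp)) hnormal hN'
  refine hS.mem_orthogonal_horizontalImage_iff.2 fun w => ?_
  obtain ⟨x, hx⟩ := hS.exists_contact_dz_eq p w
  obtain ⟨y, hy⟩ := hS.exists_contact_dz_eq p v
  have hxy : inner ℂ (S.dz p w) (N' v) = inner ℂ (S.dz p x) (N' y) := by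
    rw [← hx, hcomm, ← hy, hcomm]
  have hxJy : inner ℂ (S.dz p x) (N' (S.J p y)) = -Complex.I * inner ℂ (S.dz p x) (N' y) := by
    rw [hcomm, dz_J, inner_smul_left, Complex.conj_I, hcomm]
  have hIIxy : inner ℂ (S.dz p x) ((1 / 2 : ℂ) • (N' y + Complex.I • N' (S.J p y))) = 0 := by
    have hII0 := hII _ _ isOpen_univ (hS.isNormalFieldOn_univ hN hnormal) p trivial x y
    rw [secondFundamentalForm, covDerivBar, covDeriv_ofLp hN', covDeriv_ofLp hN',
      neg_eq_zero] at hII0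
    exact inner_eq_zero_symm.1 ((levi_eq_inner (S.dz p x) _).symm.trans hII0)
  rw [inner_smul_right, inner_add_right, inner_smul_right, hxJy] at hIIxy
  rw [hxy]
  linear_combination hIIxy + inner ℂ (S.dz p x) (N' y) / 2 * Complex.I_mul_I

theorem IsVertical.contMDiff_starProjection (hS : S.IsVertical) :
    ContMDiff (𝓡 (2 * m + 1)) 𝓘(ℝ, EuclideanSpace ℂ (Fin n) →L[ℝ] EuclideanSpace ℂ (Fin n)) ∞
      fun q => (S.horizontalImage q).starProjection := by
  intro p
  have : IsManifold (𝓡 (2 * m + 1)) (∞ + 1) M := ‹IsManifold (𝓡 (2 * m + 1)) ∞ M›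
  have : IsManifold (𝓡 (2 * m + 1)) 1 M := .of_le (n := ∞) (by simp)
  let A (q : M) : EuclideanSpace ℝ (Fin (2 * m + 1)) →L[ℝ] EuclideanSpace ℂ (Fin n) :=
    mfderivInChart ℝ S.zMap p q
  have hrange : ∀ q ∈ (chartAt (EuclideanSpace ℝ (Fin (2 * m + 1))) p).source,
      (A q).range = S.horizontalImage q := fun q hq => by
    rw [range_mfderivInChart (S.contMDiff_zMap.mdifferentiable (by simp) q) hq, mfderiv_zMap]
    rfl
  have hp := mem_chart_source (EuclideanSpace ℝ (Fin (2 * m + 1))) p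
  have hsource := (chartAt (EuclideanSpace ℝ (Fin (2 * m + 1))) p).open_source.mem_nhds hp
  have hA := contMDiffAt_mfderivInChart (k := ∞) (S.contMDiff_zMap p) hp
  refine (contMDiffAt_starProjection_range hA ?_).congr_of_eventuallyEq ?_
  · filter_upwards [hsource] with q hq
    rw [hrange q hq, hrange p hp, hS.finrank_horizontalImage, hS.finrank_horizontalImage]
  · filter_upwards [hsource] with q hq
    simp only [← hrange q hq, A]

theorem SecondFundamentalFormVanishes.mfderiv_starProjection_eq_zero
    (hII : S.SecondFundamentalFormVanishes) (hS : S.IsVertical) (p : M) :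
    mfderiv (𝓡 (2 * m + 1)) 𝓘(ℝ, EuclideanSpace ℂ (Fin n) →L[ℝ] EuclideanSpace ℂ (Fin n))
      (fun q => (S.horizontalImage q).starProjection) p = 0 := by
  have hP := (hS.contMDiff_starProjection.mdifferentiable (by simp) p).hasMFDerivAt
  refine hasMFDerivAt_isStarProjection_eq_zero (fun q => isStarProjection_starProjection)
    hP fun v => ContinuousLinearMap.ext fun c => ?_
  have hN : ContMDiff (𝓡 (2 * m + 1)) 𝓘(ℝ, EuclideanSpace ℂ (Fin n)) ∞
      fun q => c - (S.horizontalImage q).starProjection c :=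
    contMDiff_const.sub (hS.contMDiff_starProjection.clm_apply contMDiff_const)
  have hN' := (hasMFDerivAt_const c p).sub
    ((ContinuousLinearMap.apply ℝ (EuclideanSpace ℂ (Fin n)) c).hasMFDerivAt.comp p hP)
  have hperp := hII.mem_orthogonal_horizontalImage hS hN
    (fun q => Submodule.sub_starProjection_mem_orthogonal c) hN' v
  exact (Submodule.starProjection_apply_eq_zero_iff _).2
    (neg_mem_iff.1 (zero_sub (G := EuclideanSpace ℂ (Fin n)) _ ▸ hperp))

theorem SecondFundamentalFormVanishes.horizontalImage_eq [PreconnectedSpace M]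
    (hII : S.SecondFundamentalFormVanishes) (hS : S.IsVertical) (p q : M) :
    S.horizontalImage p = S.horizontalImage q := by
  have : IsManifold (𝓡 (2 * m + 1)) 1 M := .of_le (n := ∞) (by simp)
  exact Submodule.starProjection_inj.1 <| (isLocallyConstant_of_mfderiv_eq_zero
    (hS.contMDiff_starProjection.mdifferentiable (by simp))
    (hII.mfderiv_starProjection_eq_zero hS)).apply_eq_of_preconnectedSpace p q

theorem SecondFundamentalFormVanishes.exists_unitary_mulVec_dz_eq_zero [ConnectedSpace M]
    (hII : S.SecondFundamentalFormVanishes) (hS : S.IsVertical) :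
    ∃ U : Matrix.unitaryGroup (Fin n) ℂ, ∀ (q : M) (v) (β : Fin n), m ≤ β →
      (U : Matrix (Fin n) (Fin n) ℂ).mulVec (S.dz q v) β = 0 := by
  obtain ⟨p⟩ := (inferInstance : Nonempty M)
  obtain ⟨U, hU⟩ := exists_unitary_mulVec_eq_zero (hS.complexHorizontalImage p)
  rw [hS.finrank_complexHorizontalImage] at hU
  refine ⟨U, fun q v β hβ => hU _ ?_ β hβ⟩
  change S.dz q v ∈ S.horizontalImage p
  rw [hII.horizontalImage_eq hS p q]
  exact ⟨v, rfl⟩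

variable {U : Matrix.unitaryGroup (Fin n) ℂ}

theorem exists_rigidMotion_mem_coordinateSubgroup [ConnectedSpace M]
    (hU : ∀ (q : M) (v) (β : Fin n), m ≤ β →
      (U : Matrix (Fin n) (Fin n) ℂ).mulVec (S.dz q v) β = 0) :
    ∃ a, ∀ q, rigidMotion a U (S.toFun q) ∈ coordinateSubgroup m n := by
  have : IsManifold (𝓡 (2 * m + 1)) 1 M := .of_le (n := ∞) (by simp)
  obtain ⟨p⟩ := (inferInstance : Nonempty M)
  have hconst : ∀ (β : Fin n), m ≤ β → ∀ q,
      (rigidMotionLinear 0 U (S.toFun q)).1 β = (rigidMotionLinear 0 U (S.toFun p)).1 β := by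
    intro β hβ q
    let L : Heisenberg n →L[ℝ] ℂ := ContinuousLinearMap.proj (R := ℝ) (φ := fun _ : Fin n => ℂ) β ∘L
      ContinuousLinearMap.fst ℝ (Fin n → ℂ) ℝ ∘L rigidMotionLinear 0 U
    have hderiv q := L.hasMFDerivAt.comp q
      (S.smooth.mdifferentiable (by simp) q).hasMFDerivAt
    exact (isLocallyConstant_of_mfderiv_eq_zero (fun q => (hderiv q).mdifferentiableAt)
      fun q => (hderiv q).mfderiv.trans (ContinuousLinearMap.ext fun v => hU q v β hβ)
      ).apply_eq_of_preconnectedSpace q p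
  refine ⟨(-(rigidMotionLinear 0 U (S.toFun p)).1, 0), fun q β hβ => ?_⟩
  rw [coe_rigidMotion]
  exact neg_add_eq_zero.2 (hconst β hβ q).symm

theorem isOpenEmbedding_forget_rigidMotion (h : m ≤ n) {a : Heisenberg n}
    (hU : ∀ (q : M) (v) (β : Fin n), m ≤ β →
      (U : Matrix (Fin n) (Fin n) ℂ).mulVec (S.dz q v) β = 0)
    (ha : ∀ q, rigidMotion a U (S.toFun q) ∈ coordinateSubgroup m n) :
    Topology.IsOpenEmbedding (forget h ∘ rigidMotion a U ∘ S.toFun) := by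
  have : IsManifold (𝓡 (2 * m + 1)) 1 M := .of_le (n := ∞) (by simp)
  have hsmooth : ContMDiff (𝓡 (2 * m + 1)) 𝓘(ℝ, Heisenberg m) ∞
      (forget h ∘ rigidMotion a U ∘ S.toFun) :=
    (forget h).contDiff.contMDiff.comp ((contDiff_rigidMotion a U).contMDiff.comp S.smooth)
  have hderiv q : HasMFDerivAt (𝓡 (2 * m + 1)) 𝓘(ℝ, Heisenberg m)
      (forget h ∘ rigidMotion a U ∘ S.toFun) q
      (forget h ∘L rigidMotionLinear a.1 U ∘L tangentMapAt m S.toFun q) :=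
    (forget h).hasMFDerivAt.comp q ((hasFDerivAt_rigidMotion a U _).hasMFDerivAt.comp q
      (S.smooth.mdifferentiable (by simp) q).hasMFDerivAt)
  refine .of_continuous_injective_isOpenMap hsmooth.continuous (fun q r hqr => ?_)
    (isOpenMap_of_mfderiv_injective ?_ (hsmooth.of_le (by simp)) fun q => ?_)
  · exact S.injective ((rigidMotion a U).injective (injOn_forget h (ha q) (ha r) hqr))
  · rw [finrank_euclideanSpace_fin, finrank_real_heisenberg]
  · have hmem v : rigidMotionLinear a.1 U (tangentMapAt m S.toFun q v) ∈
        coordinateSubgroup m n := hU q v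
    rw [(hderiv q).mfderiv]
    exact fun v w hvw => S.immersion q <|
      rigidMotionLinear_injective a.1 U (injOn_forget h (hmem v) (hmem w) hvw)

end PseudohermitianSubmanifold

theorem theoremC_general {m n : ℕ} {M : Type*} [TopologicalSpace M]
    [ChartedSpace (EuclideanSpace ℝ (Fin (2 * m + 1))) M]
    [IsManifold (𝓡 (2 * m + 1)) ∞ M] [ConnectedSpace M] (S : PseudohermitianSubmanifold m n M)
    (hvertical : S.IsVertical) (hII : S.SecondFundamentalFormVanishes) :
    Topology.IsEmbedding S.toFun ∧
      ∃ Φ : Heisenberg n ≃ Heisenberg n, Heisenberg.IsRigidMotion Φ ∧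
        ∃ V : Set (Heisenberg n), IsOpen V ∧
          Φ '' Set.range S.toFun = V ∩ Heisenberg.coordinateSubgroup m n := by
  have hmn : m ≤ n := hvertical.dim_le
  obtain ⟨U, hU⟩ := hII.exists_unitary_mulVec_dz_eq_zero hvertical
  obtain ⟨a, ha⟩ := PseudohermitianSubmanifold.exists_rigidMotion_mem_coordinateSubgroup hU
  have hopen := PseudohermitianSubmanifold.isOpenEmbedding_forget_rigidMotion hmn hU ha
  have hforget := (Heisenberg.forget hmn).continuous
  refine ⟨.of_comp S.smooth.continuous
    (hforget.comp (Heisenberg.contDiff_rigidMotion a U).continuous) hopen.isEmbedding,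
    Heisenberg.rigidMotion a U, Heisenberg.isRigidMotion_rigidMotion a U,
    _, hopen.isOpen_range.preimage hforget, Set.Subset.antisymm ?_ ?_⟩
  · rintro _ ⟨_, ⟨q, rfl⟩, rfl⟩
    exact ⟨⟨q, rfl⟩, ha q⟩
  · rintro x ⟨⟨q, hq⟩, hx⟩
    exact ⟨_, ⟨q, rfl⟩, Heisenberg.injOn_forget hmn (ha q) hx hq⟩

/-- A vertical, simply connected pseudohermitian submanifold `M` of `H_n`, `n = m + 1`, of CR
dimension `m = n - 1 ≥ 1` with `II = 0` is, after a Heisenberg rigid motion, an open subset of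
`H_{n-1} = {z_n = 0}`. As `M` is smoothly immersed, it carries the topology and the smooth structure
of that open subset once its inclusion is a topological embedding. -/
theorem theoremC (m : ℕ) (hm : 1 ≤ m) (M : Type*) [TopologicalSpace M]
    [ChartedSpace (EuclideanSpace ℝ (Fin (2 * m + 1))) M]
    [IsManifold (𝓡 (2 * m + 1)) ∞ M] [SimplyConnectedSpace M]
    (S : PseudohermitianSubmanifold m (m + 1) M)
    (hvertical : S.IsVertical) (hII : S.SecondFundamentalFormVanishes) :
    Topology.IsEmbedding S.toFun ∧
      ∃ Φ : Heisenberg (m + 1) ≃ Heisenberg (m + 1), Heisenberg.IsRigidMotion Φ ∧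
        ∃ V : Set (Heisenberg (m + 1)), IsOpen V ∧
          Φ '' Set.range S.toFun = V ∩ Heisenberg.subgroup m :=
  Heisenberg.coordinateSubgroup_succ m ▸ theoremC_general S hvertical hII
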